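/- Let $F_1=1$, $F_2=2$ and $F_{i+1}=F_i+F_{i-1}$ for $i\ge 2$, and let $\phi=\frac{1+\sqrt5}{2}$. The ordered Zeckendorf game on a positive integer $n$ starts with the $n$-tuple $(F_1,\dots,F_1)$. A move acts on two adjacent terms of the current tuple and is one of the following: a merge $(F_i,F_{i+1})\to F_{i+2}$ for $i\ge1$; a merging of ones $(F_1,F_1)\to F_2$; a split, which is $(F_i,F_i)\to(F_{i-2},F_{i+1})$ for $i>2$ or $(F_2,F_2)\to(F_1,F_3)$; or a switch $(F_i,F_j)\to(F_j,F_i)$ for $i>j$. The game ends when no move is possible, and its length is the number of moves made. Let $M(n)$ be the maximal length of a game on $n$. The Long Game Strategy prescribes, at each moment, the first of the following that is possible: (1) any switch move; (2) the leftmost merging of ones; (3) the rightmost split move; (4) the leftmost merge move. Theorem. There is a function $e:\mathbb{N}\to\mathbb{R}$ with $e(n)=o(n\log_\phi n)$ as $n\to\infty$ such that for every $n\ge1$ the Long Game Strategy can be played to the end of the game on $n$, and every game on $n$ that is played by the Long Game Strategy has at least $$\frac{n^2}{2}-n\log_\phi(n)+e(n)$$ moves. Consequently the maximum $M(n)$,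 which exists, satisfies $$M(n)\ \ge\ \frac{n^2}{2}-n\log_\phi(n)+e(n)\qquad\text{for all } n\ge1.$$ -/

import Mathlib

namespace OrderedZeckendorf

/-- The five types of legal moves. -/
inductive MoveType where
  | merge
  | mergeOnes
  | split
  | splitTwos
  | switch

/-- A state of the game is the tuple `(F_{i₁}, …, F_{iₖ})`, recorded by its list of indices
`[i₁, …, iₖ]`; here `F_1 = 1`, `F_2 = 2`, `F_{i+1} = F_i + F_{i-1}`, so that `i ↦ F_i` is strictly
increasing on `i ≥ 1` and the indices determine the terms and conversely. -/
abbrev State : Type := List ℕ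

/-- `Replaces k a b w`: a move of type `k` replaces the adjacent pair `(F_a, F_b)` by the tuple with
list of indices `w`. -/
inductive Replaces : MoveType → ℕ → ℕ → List ℕ → Prop
  | merge (i : ℕ) (hi : 1 ≤ i) : Replaces MoveType.merge i (i + 1) [i + 2]
  | mergeOnes : Replaces MoveType.mergeOnes 1 1 [2]
  | split (i : ℕ) (hi : 2 < i) : Replaces MoveType.split i i [i - 2, i + 1]
  | splitTwos : Replaces MoveType.splitTwos 2 2 [1, 3]
  | switch (i j : ℕ) (hij : j < i) : Replaces MoveType.switch i j [j, i]

/-- `MoveAt k p s t`: the state `t` arises from `s` by a move of type `k` on the adjacent pair in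
positions `p`, `p + 1` (positions are counted from the left, starting with `0`). -/
def MoveAt (k : MoveType) (p : ℕ) (s t : State) : Prop :=
  ∃ (l r : List ℕ) (a b : ℕ) (w : List ℕ), l.length = p ∧ Replaces k a b w ∧
    s = l ++ a :: b :: r ∧ t = l ++ w ++ r

/-- A legal move of the ordered Zeckendorf game. -/
def Move (s t : State) : Prop := ∃ (k : MoveType) (p : ℕ), MoveAt k p s t

/-- A move of type `k` is possible in state `s` at position `p`. -/
def Possible (k : MoveType) (p : ℕ) (s : State) : Prop := ∃ t, MoveAt k p s t

/-- `SplitAt p s t`: a split move (an ordinary one or a splitting of twos) at position `p`. -/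
def SplitAt (p : ℕ) (s t : State) : Prop :=
  MoveAt MoveType.split p s t ∨ MoveAt MoveType.splitTwos p s t

/-- Some split move is possible in state `s` at position `p`. -/
def SplitPossible (p : ℕ) (s : State) : Prop := ∃ t, SplitAt p s t

/-- A move made according to the Long Game Strategy: any switch move, if there is one; otherwise the
leftmost merging of ones, if there is one; otherwise the rightmost split move, if there is one;
otherwise the leftmost merge move. -/
inductive LGSMove (s t : State) : Prop
  | switch (p : ℕ) (h : MoveAt MoveType.switch p s t)
  | mergeOnes (p : ℕ) (h : MoveAt MoveType.mergeOnes p s t)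
      (noSwitch : ∀ q, ¬ Possible MoveType.switch q s)
      (leftmost : ∀ q, q < p → ¬ Possible MoveType.mergeOnes q s)
  | split (p : ℕ) (h : SplitAt p s t)
      (noSwitch : ∀ q, ¬ Possible MoveType.switch q s)
      (noMergeOnes : ∀ q, ¬ Possible MoveType.mergeOnes q s)
      (rightmost : ∀ q, p < q → ¬ SplitPossible q s)
  | merge (p : ℕ) (h : MoveAt MoveType.merge p s t)
      (noSwitch : ∀ q, ¬ Possible MoveType.switch q s)
      (noMergeOnes : ∀ q, ¬ Possible MoveType.mergeOnes q s)
      (noSplit : ∀ q, ¬ SplitPossible q s)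
      (leftmost : ∀ q, q < p → ¬ Possible MoveType.merge q s)

/-- The starting state `(F_1, …, F_1)` with `n` terms. -/
def start (n : ℕ) : State := List.replicate n 1

/-- No legal move is possible. -/
def Terminal (s : State) : Prop := ∀ t, ¬ Move s t

/-- `Steps R m s t`: `t` can be reached from `s` by exactly `m` moves, each permitted by `R`. -/
inductive Steps (R : State → State → Prop) : ℕ → State → State → Prop
  | refl (s : State) : Steps R 0 s s
  | step {m : ℕ} {s t u : State} (h : Steps R m s t) (h' : R t u) : Steps R (m + 1) s u

/-- There is a complete game on `n` (from the starting state to a state without legal moves) that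
has exactly `m` moves. -/
def IsGameLength (n m : ℕ) : Prop := ∃ t, Steps Move m (start n) t ∧ Terminal t

/-- There is a complete game on `n`, all of whose moves follow the Long Game Strategy, that has
exactly `m` moves. -/
def IsLGSGameLength (n m : ℕ) : Prop := ∃ t, Steps LGSMove m (start n) t ∧ Terminal t

/-- The maximal length `M(n)` of an ordered Zeckendorf game on `n`. -/
noncomputable def maxGameLength (n : ℕ) : ℕ := sSup {m : ℕ | IsGameLength n m}

end OrderedZeckendorf

/-! Let `c` be the number of ones in a state, `S` twice its length minus `c`, and `A = log_φ n + 3`.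
Consider the potential `inversions + c²/4 + S²/4 - A·S`. It is at least `n²/2 - A·n` at the start,
where `c = S = n`, and at most 1 at a terminal state, and no move of the Long Game Strategy lowers
it by more than 1 (`potential_lgsMove`). Hence every such game has at least `n²/2 - n log_φ n - (3n
+ 1)` moves.

Switches lower the potential by exactly 1. The other moves happen only in sorted states, and the
inversions they create pay for the loss in the quadratic terms. Merging ones puts a 2 before the
remaining ones; splitting twos or threes puts a 1 behind all terms on its left. The unpaid part of a
split comes from the terms on its right. These are distinct because the split is the rightmost one,
so there are at most `log_φ n + 1` of them (`length_le_logb`), and the term `-A·S` covers them.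

The maximum exists because weight and inversions, ordered lexicographically, decrease in every move
(`Move.measure_lt`). -/

namespace OrderedZeckendorf

/-! ### Inversions, value and weight of a state -/

/-- The number of pairs of positions that are in the wrong order. -/
def inversions : List ℕ → ℕ
  | [] => 0
  | a :: l => l.countP (· < a) + inversions l

/-- The integer represented by a state. -/
def value (s : State) : ℕ := (s.map fun i => Nat.fib (i + 1)).sum

/-- The weight of an index; the total weight decreases in every move but the switches. -/
def indexWeight (i : ℕ) : ℕ := if i ≤ 1 then 3 else i + 3

/-- The total weight of a state. -/
def weight (s : State) : ℕ := (s.map indexWeight).sum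

theorem inversions_switch (l r : List ℕ) {i j : ℕ} (h : j < i) :
    inversions (l ++ i :: j :: r) = inversions (l ++ j :: i :: r) + 1 := by
  induction l with
  | nil =>
    have : ¬ i < j := by omega
    simp [inversions, h, this]
    omega
  | cons a l ih =>
    have := ((List.Perm.swap j i r).append_left l).countP_eq (· < a)
    simp only [List.cons_append, inversions]
    omega

theorem inversions_le_sq (s : List ℕ) : inversions s ≤ s.length ^ 2 := by
  induction s with
  | nil => simp [inversions]
  | cons a l ih =>
    have := List.countP_le_length (p := (· < a)) (l := l)
    simp only [inversions, List.length_cons]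
    nlinarith

theorem inversions_eq_zero {s : List ℕ} (h : s.Pairwise (· ≤ ·)) : inversions s = 0 := by
  induction s with
  | nil => rfl
  | cons a l ih =>
    rw [List.pairwise_cons] at h
    simp only [inversions, ih h.2, add_zero, List.countP_eq_zero]
    intro b hb
    simpa using h.1 b hb

theorem countP_le_inversions_cons (l : List ℕ) (a : ℕ) :
    l.countP (· < a) ≤ inversions (a :: l) := by
  simp [inversions]

theorem countP_le_inversions_append_cons (l r : List ℕ) (a : ℕ) :
    l.countP (a < ·) ≤ inversions (l ++ a :: r) := by
  induction l with
  | nil => simp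
  | cons b l ih =>
    simp only [List.cons_append, inversions, List.countP_cons, List.countP_append]
    split_ifs <;> simp_all <;> omega

/-! ### Effect of a move -/

/-- The weight `i + 3` for every index would be unchanged by splitting twos; lowering the weight of
index 1 from 4 to 3 makes it drop. The offset 3 is large enough for two ones (weight 6) to outweigh
a two (weight 5). -/
theorem MoveAt.cases {k : MoveType} {p : ℕ} {s t : State} (h : MoveAt k p s t) :
    k = MoveType.switch ∨ weight t < weight s := by
  obtain ⟨l, r, a, b, w, -, hw, rfl, rfl⟩ := h
  cases hw with
  | switch => exact Or.inl rfl
  | merge i hi =>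
    right; simp [weight, indexWeight]; split_ifs <;> omega
  | mergeOnes => right; simp [weight, indexWeight]; omega
  | split i hi =>
    right; simp [weight, indexWeight]; split_ifs <;> omega
  | splitTwos => right; simp [weight, indexWeight]; omega

theorem MoveAt.switch_weight {p : ℕ} {s t : State} (h : MoveAt MoveType.switch p s t) :
    weight t = weight s ∧ inversions s = inversions t + 1 := by
  obtain ⟨l, r, a, b, w, -, hw, rfl, rfl⟩ := h
  cases hw with
  | switch _ _ hij =>
    refine ⟨by simp [weight]; omega, ?_⟩
    simpa using inversions_switch l r hij

theorem MoveAt.length_le {k : MoveType} {p : ℕ} {s t : State} (h : MoveAt k p s t) :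
    t.length ≤ s.length := by
  obtain ⟨l, r, a, b, w, -, hw, rfl, rfl⟩ := h
  cases hw <;> simp

theorem MoveAt.pos_lt {k : MoveType} {p : ℕ} {s t : State} (h : MoveAt k p s t) :
    p < s.length := by
  obtain ⟨l, r, a, b, w, rfl, hw, rfl, rfl⟩ := h
  simp

theorem Replaces.value_eq {k : MoveType} {a b : ℕ} {w : List ℕ} (h : Replaces k a b w) :
    value w = value [a, b] := by
  cases h with
  | merge i hi => simp [value, Nat.fib_add_two (n := a + 1)]
  | mergeOnes => simp [value, Nat.fib]
  | split i hi =>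
    obtain ⟨j, rfl⟩ : ∃ j, a = j + 2 := ⟨a - 2, by omega⟩
    have h1 := Nat.fib_add_two (n := j + 1)
    have h2 := Nat.fib_add_two (n := j + 2)
    simp only [value, List.map_cons, List.map_nil, List.sum_cons, List.sum_nil,
      Nat.add_sub_cancel]
    ring_nf at h1 h2 ⊢
    omega
  | splitTwos => simp [value, Nat.fib]
  | switch i j _ => simp [value, add_comm]

theorem MoveAt.value_eq {k : MoveType} {p : ℕ} {s t : State} (h : MoveAt k p s t) :
    value t = value s := by
  obtain ⟨l, r, a, b, w, -, hw, rfl, rfl⟩ := h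
  have := hw.value_eq
  simp only [value, List.map_append, List.sum_append, List.map_cons, List.sum_cons, List.map_nil,
    List.sum_nil] at this ⊢
  omega

theorem MoveAt.forall_one_le {k : MoveType} {p : ℕ} {s t : State} (h : MoveAt k p s t)
    (hs : ∀ i ∈ s, 1 ≤ i) : ∀ i ∈ t, 1 ≤ i := by
  obtain ⟨l, r, a, b, w, -, hw, rfl, rfl⟩ := h
  intro i hi
  simp only [List.mem_append, List.mem_cons] at hi hs
  rcases hi with (hi | hi) | hi
  · exact hs i (Or.inl hi)
  · have ha := hs a (by simp)
    have hb := hs b (by simp)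
    cases hw <;> simp at hi <;> omega
  · exact hs i (by simp [hi])

/-! ### Termination -/

/-- The factor `n ^ 2 + 1` exceeds every possible number of inversions, so a single number encodes
the lexicographic order on weight and inversions. -/
theorem Move.measure_lt {n : ℕ} {s t : State} (h : Move s t) (hs : s.length ≤ n) :
    weight t * (n ^ 2 + 1) + inversions t < weight s * (n ^ 2 + 1) + inversions s := by
  obtain ⟨k, p, h⟩ := h
  rcases h.cases with rfl | hw
  · obtain ⟨h1, h2⟩ := h.switch_weight
    rw [h1]
    omega
  · have h1 : inversions t ≤ n ^ 2 :=
      (inversions_le_sq t).trans (Nat.pow_le_pow_left (h.length_le.trans hs) 2)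
    have h2 : (weight t + 1) * (n ^ 2 + 1) ≤ weight s * (n ^ 2 + 1) := Nat.mul_le_mul_right _ hw
    linarith

theorem Steps.measure_le {n m : ℕ} {s t : State} (h : Steps Move m s t) (hs : s.length ≤ n) :
    t.length ≤ n ∧
      weight t * (n ^ 2 + 1) + inversions t + m ≤ weight s * (n ^ 2 + 1) + inversions s := by
  induction h with
  | refl => exact ⟨hs, le_rfl⟩
  | step _ h' ih =>
    obtain ⟨h1, h2⟩ := ih hs
    have h3 := h'.measure_lt h1
    obtain ⟨k, p, h'⟩ := h'
    exact ⟨h'.length_le.trans h1, by omega⟩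

theorem bddAbove_isGameLength (n : ℕ) : BddAbove {m : ℕ | IsGameLength n m} := by
  refine ⟨weight (start n) * (n ^ 2 + 1) + inversions (start n), ?_⟩
  rintro m ⟨t, ht, -⟩
  have := (ht.measure_le (n := n) (by simp [start])).2
  omega

theorem LGSMove.move {s t : State} (h : LGSMove s t) : Move s t := by
  cases h with
  | switch p h => exact ⟨_, p, h⟩
  | mergeOnes p h => exact ⟨_, p, h⟩
  | split p h => exact h.elim (fun h => ⟨_, p, h⟩) (fun h => ⟨_, p, h⟩)
  | merge p h => exact ⟨_, p, h⟩

theorem Steps.mono {R S : State → State → Prop} (hRS : ∀ s t, R s t → S s t) {m : ℕ}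
    {s t : State} (h : Steps R m s t) : Steps S m s t := by
  induction h with
  | refl => exact .refl _
  | step _ h' ih => exact .step ih (hRS _ _ h')

theorem IsLGSGameLength.isGameLength {n m : ℕ} (h : IsLGSGameLength n m) : IsGameLength n m := by
  obtain ⟨t, ht, hT⟩ := h
  exact ⟨t, ht.mono fun _ _ => LGSMove.move, hT⟩

theorem exists_lgsMove {s : State} (h : ¬ Terminal s) : ∃ t, LGSMove s t := by
  classical
  by_cases h1 : ∃ q, Possible MoveType.switch q s
  · obtain ⟨q, t, ht⟩ := h1
    exact ⟨t, .switch q ht⟩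
  by_cases h2 : ∃ q, Possible MoveType.mergeOnes q s
  · obtain ⟨t, ht⟩ := Nat.find_spec h2
    exact ⟨t, .mergeOnes _ ht (not_exists.mp h1) fun q => Nat.find_min h2⟩
  by_cases h3 : ∃ q, SplitPossible q s
  · obtain ⟨q, hq⟩ := h3
    have hlt : ∀ q, SplitPossible q s → q < s.length := by
      rintro q ⟨t, ht | ht⟩ <;> exact ht.pos_lt
    obtain ⟨t, ht⟩ := Nat.findGreatest_spec (P := fun q => SplitPossible q s) (hlt q hq).le hq
    refine ⟨t, .split _ ht (not_exists.mp h1) (not_exists.mp h2) fun q' hq' hs => ?_⟩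
    exact Nat.findGreatest_is_greatest hq' (hlt q' hs).le hs
  by_cases h4 : ∃ q, Possible MoveType.merge q s
  · obtain ⟨t, ht⟩ := Nat.find_spec h4
    exact ⟨t, .merge _ ht (not_exists.mp h1) (not_exists.mp h2) (not_exists.mp h3)
      fun q => Nat.find_min h4⟩
  refine absurd (fun t => ?_) h
  rintro ⟨k, p, hk⟩
  cases k with
  | merge => exact h4 ⟨p, t, hk⟩
  | mergeOnes => exact h2 ⟨p, t, hk⟩
  | split => exact h3 ⟨p, t, Or.inl hk⟩
  | splitTwos => exact h3 ⟨p, t, Or.inr hk⟩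
  | switch => exact h1 ⟨p, t, hk⟩

theorem exists_isLGSGameLength (n : ℕ) : ∃ m, IsLGSGameLength n m := by
  have key : ∀ M : ℕ, ∀ m s, Steps LGSMove m (start n) s → s.length ≤ n →
      weight s * (n ^ 2 + 1) + inversions s ≤ M → ∃ m, IsLGSGameLength n m := by
    intro M
    induction M with
    | zero =>
      intro m s hs hl hM
      by_cases hT : Terminal s
      · exact ⟨m, s, hs, hT⟩
      · obtain ⟨t, ht⟩ := exists_lgsMove hT
        have := ht.move.measure_lt hl
        omega
    | succ M ih =>
      intro m s hs hl hM
      by_cases hT : Terminal s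
      · exact ⟨m, s, hs, hT⟩
      · obtain ⟨t, ht⟩ := exists_lgsMove hT
        have := ht.move.measure_lt hl
        obtain ⟨k, p, hk⟩ := ht.move
        exact ih (m + 1) t (.step hs ht) (hk.length_le.trans hl) (by omega)
  exact key _ 0 (start n) (.refl _) (by simp [start]) le_rfl


/-! ### States without moves of a given type -/

theorem isChain_le {s : State} (h : ∀ q, ¬ Possible MoveType.switch q s) :
    s.IsChain (· ≤ ·) := by
  rw [List.isChain_iff_forall_rel_of_append_cons_cons]
  intro a b l r hs
  by_contra hab
  exact h l.length ⟨_, l, r, a, b, [b, a], rfl, .switch a b (by omega), hs, rfl⟩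

/-- A transitive relation that expresses at once that the state is sorted and that only its head can
be 1. -/
theorem pairwise_le_and_one_lt {s : State} (hs : ∀ i ∈ s, 1 ≤ i)
    (h : ∀ q, ¬ Possible MoveType.switch q s) (h' : ∀ q, ¬ Possible MoveType.mergeOnes q s) :
    s.Pairwise fun a b => a ≤ b ∧ 1 < b := by
  have : Trans (fun a b : ℕ => a ≤ b ∧ 1 < b) (fun a b : ℕ => a ≤ b ∧ 1 < b)
      (fun a b : ℕ => a ≤ b ∧ 1 < b) := ⟨fun h1 h2 => ⟨h1.1.trans h2.1, h2.2⟩⟩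
  rw [← List.isChain_iff_pairwise, List.isChain_iff_forall_rel_of_append_cons_cons]
  intro a b l r hl
  have hab := List.isChain_iff_forall_rel_of_append_cons_cons.mp (isChain_le h) hl
  refine ⟨hab, ?_⟩
  by_contra hb
  have ha1 : 1 ≤ a := hs a (by simp [hl])
  obtain rfl : a = 1 := by omega
  obtain rfl : b = 1 := by omega
  exact h' l.length ⟨_, l, r, 1, 1, [2], rfl, .mergeOnes, hl, rfl⟩

theorem countP_one_lt {s : List ℕ} (hs : s.Pairwise fun a b => a ≤ b ∧ 1 < b) :
    s.length ≤ s.countP (1 < ·) + 1 := by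
  cases s with
  | nil => simp
  | cons a s =>
    rw [List.pairwise_cons] at hs
    have : s.countP (1 < ·) = s.length := by
      rw [List.countP_eq_length]
      exact fun b hb => by simpa using (hs.1 b hb).2
    simp only [List.countP_cons, List.length_cons]
    omega

theorem count_one_le {s : List ℕ} (hs : s.Pairwise fun a b => a ≤ b ∧ 1 < b) :
    s.count 1 ≤ 1 := by
  cases s with
  | nil => simp
  | cons a s =>
    rw [List.pairwise_cons] at hs
    have : s.count 1 = 0 := by
      rw [List.count_eq_zero]
      exact fun h => absurd (hs.1 1 h).2 (by simp)
    rw [List.count_cons, this]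
    split_ifs <;> simp

theorem splitPossible_append {l r : List ℕ} {a : ℕ} (ha : 1 < a) :
    SplitPossible l.length (l ++ a :: a :: r) := by
  rcases eq_or_lt_of_le (show 2 ≤ a from ha) with rfl | ha
  · exact ⟨_, Or.inr ⟨l, r, 2, 2, _, rfl, .splitTwos, rfl, rfl⟩⟩
  · exact ⟨_, Or.inl ⟨l, r, a, a, _, rfl, .split a ha, rfl, rfl⟩⟩

/-- Past the last position at which a split is possible, the terms are distinct. -/
theorem pairwise_lt_of_not_splitPossible {l r : List ℕ}
    (hs : (l ++ r).Pairwise fun a b => a ≤ b ∧ 1 < b)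
    (h : ∀ q, l.length ≤ q → ¬ SplitPossible q (l ++ r)) : r.Pairwise (· < ·) := by
  rw [← List.isChain_iff_pairwise, List.isChain_iff_forall_rel_of_append_cons_cons]
  rintro a b u v rfl
  have hs' := List.pairwise_append.mp (List.pairwise_append.mp hs).2.1
  have hab := List.rel_of_pairwise_cons hs'.2.1 (List.mem_cons_self (a := b) (l := v))
  refine lt_of_le_of_ne hab.1 ?_
  rintro rfl
  refine h (l ++ u).length (by simp) ?_
  simpa using splitPossible_append (l := l ++ u) (r := v) hab.2

/-! ### States with distinct terms are short -/

open Real in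
theorem goldenRatio_pow_le_fib (k : ℕ) : goldenRatio ^ k ≤ Nat.fib (k + 2) := by
  induction k using Nat.twoStepInduction with
  | zero => simp
  | one => simpa [Nat.fib] using goldenRatio_lt_two.le
  | more k h1 h2 =>
    have h3 := Nat.fib_add_two (n := k + 2)
    have h4 : goldenRatio ^ (k + 2) = goldenRatio ^ k + goldenRatio ^ (k + 1) := by
      rw [pow_add, goldenRatio_sq]; ring
    rw [h3, h4]
    push_cast
    linarith

open Real in
-- The largest term alone suffices: in a strictly increasing list its index is at least `l.length +
-- k`. The parameter `k` carries the induction.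
theorem goldenRatio_pow_le_value {l : List ℕ} (hl : l.Pairwise (· < ·)) (k : ℕ)
    (hk : ∀ i ∈ l, k < i) (h0 : l ≠ []) :
    goldenRatio ^ (l.length + k) ≤ goldenRatio * value l := by
  induction l generalizing k with
  | nil => exact absurd rfl h0
  | cons a l ih =>
    have hka := hk a (by simp)
    rw [List.pairwise_cons] at hl
    have hv : value (a :: l) = Nat.fib (a + 1) + value l := by simp [value]
    rw [hv]
    push_cast
    rcases eq_or_ne l [] with rfl | hne
    · have h1 := goldenRatio_pow_le_fib k
      have h2 : (Nat.fib (k + 2) : ℝ) ≤ Nat.fib (a + 1) := by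
        exact_mod_cast Nat.fib_mono (by omega)
      simp only [List.length_cons, List.length_nil, zero_add, value, List.map_nil, List.sum_nil,
        Nat.cast_zero, add_zero]
      rw [pow_add, pow_one]
      exact mul_le_mul_of_nonneg_left (h1.trans h2) goldenRatio_pos.le
    · have h1 := ih hl.2 (k + 1) (fun i hi => by have := hl.1 i hi; omega) hne
      have h2 : l.length + (k + 1) = (a :: l).length + k := by
        simp only [List.length_cons]; omega
      rw [← h2]
      have h3 : (0 : ℝ) ≤ goldenRatio * Nat.fib (a + 1) :=
        mul_nonneg goldenRatio_pos.le (Nat.cast_nonneg _)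
      linarith

open Real in
theorem length_le_logb {l : List ℕ} (hl : l.Pairwise (· < ·)) (h1 : ∀ i ∈ l, 1 ≤ i) {n : ℕ}
    (hn : 1 ≤ n) (hv : value l ≤ n) : (l.length : ℝ) ≤ logb goldenRatio n + 1 := by
  have hn' : (1 : ℝ) ≤ n := by exact_mod_cast hn
  rcases eq_or_ne l [] with rfl | hne
  · have := logb_nonneg one_lt_goldenRatio hn'
    simp only [List.length_nil, Nat.cast_zero]
    linarith
  have h := goldenRatio_pow_le_value hl 0 h1 hne
  have h2 : goldenRatio ^ l.length ≤ goldenRatio * n :=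
    h.trans (mul_le_mul_of_nonneg_left (by exact_mod_cast hv) goldenRatio_pos.le)
  rw [← rpow_natCast, ← le_logb_iff_rpow_le one_lt_goldenRatio
    (mul_pos goldenRatio_pos (by linarith)), logb_mul goldenRatio_ne_zero (by linarith),
    logb_self_eq_one one_lt_goldenRatio] at h2
  linarith

/-! ### The potential -/

/-- Twice the number of terms of a state, except that a term `F_1` is counted only once. -/
def size (s : State) : ℝ := 2 * s.length - s.count 1

/-- A potential that decreases by at most one in a move of the Long Game Strategy. -/
noncomputable def potential (A : ℝ) (s : State) : ℝ :=
  inversions s + (s.count 1 : ℝ) ^ 2 / 4 + size s ^ 2 / 4 - A * size s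

theorem size_nonneg (s : State) : 0 ≤ size s := by
  have : (s.count 1 : ℝ) ≤ s.length := by exact_mod_cast List.count_le_length
  have : (0 : ℝ) ≤ s.length := Nat.cast_nonneg _
  unfold size
  linarith

theorem size_le (s : State) : size s ≤ 2 * s.length := by
  have : (0 : ℝ) ≤ s.count 1 := Nat.cast_nonneg _
  unfold size
  linarith

theorem potential_switch (A : ℝ) {p : ℕ} {s t : State} (h : MoveAt MoveType.switch p s t) :
    potential A s = potential A t + 1 := by
  have h1 := h.switch_weight.2
  obtain ⟨l, r, a, b, w, -, hw, rfl, rfl⟩ := h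
  cases hw with
  | switch _ _ hij =>
    have h2 : (l ++ a :: b :: r).count 1 = (l ++ [b, a] ++ r).count 1 := by
      simpa using ((List.Perm.swap b a r).append_left l).count_eq 1
    simp only [potential, size, h1, h2]
    simp
    ring

/-- `size` does not change, and `c²/4` falls by `c - 1`. The new 2 stands before the other `c - 2`
ones and so gains that many inversions, for a net loss of at most 1. -/
theorem potential_mergeOnes (A : ℝ) {p : ℕ} {s t : State} (hs : ∀ i ∈ s, 1 ≤ i)
    (h : MoveAt MoveType.mergeOnes p s t) (h1 : ∀ q, ¬ Possible MoveType.switch q s)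
    (h2 : ∀ q, q < p → ¬ Possible MoveType.mergeOnes q s) :
    potential A s ≤ potential A t + 1 := by
  have hle := List.isChain_iff_pairwise.mp (isChain_le h1)
  obtain ⟨l, r, a, b, w, rfl, hw, rfl, rfl⟩ := h
  cases hw
  -- In a sorted state a term before the pair would be another 1, giving a mergeable pair further
  -- left.
  obtain rfl : l = [] := by
    by_contra hne
    obtain ⟨u, x, rfl⟩ := (List.eq_nil_or_concat l).resolve_left hne
    have hx1 := hs x (by simp)
    have hx2 : x ≤ 1 := (List.pairwise_append.mp hle).2.2 x (by simp) 1 (by simp)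
    obtain rfl : x = 1 := by omega
    exact h2 u.length (by simp) ⟨_, u, 1 :: r, 1, 1, [2], rfl, .mergeOnes, by simp, rfl⟩
  have h3 : r.count 1 ≤ inversions (2 :: r) := by
    refine le_trans (List.countP_mono_left fun x _ hx => ?_) (countP_le_inversions_cons r 2)
    have : x = 1 := by simpa using hx
    simp [this]
  have h3' : (r.count 1 : ℝ) ≤ inversions (2 :: r) := by exact_mod_cast h3
  have h4 := inversions_eq_zero hle
  simp only [List.nil_append] at h4 ⊢
  simp only [potential, size, h4]
  simp
  ring_nf
  ring_nf at h3'
  linarith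

/-- Only a split that creates a 1 changes `size`, lowering it by 1. The loss in `size ^ 2 / 4` is
about `l.length + r.length + 2`: the inversions with the new 1 pay for `l`, and `A` pays for
`r.length + 2`. -/
theorem potential_split {A : ℝ} {p : ℕ} {s t : State} (hs : ∀ i ∈ s, 1 ≤ i)
    (hA : ∀ r : List ℕ, r.Pairwise (· < ·) → r.Sublist s → (r.length : ℝ) + 2 ≤ A)
    (h : SplitAt p s t) (h1 : ∀ q, ¬ Possible MoveType.switch q s)
    (h2 : ∀ q, ¬ Possible MoveType.mergeOnes q s) (h3 : ∀ q, p < q → ¬ SplitPossible q s) :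
    potential A s ≤ potential A t + 1 := by
  have hle := List.isChain_iff_pairwise.mp (isChain_le h1)
  have hpw := pairwise_le_and_one_lt hs h1 h2
  have hinv := inversions_eq_zero hle
  -- Splitting twos and splitting threes both produce a 1 and are treated as one case.
  obtain ⟨l, r, a, w, rfl, rfl, rfl, ha⟩ : ∃ (l r : List ℕ) (a : ℕ) (w : List ℕ), l.length = p ∧
      s = l ++ a :: a :: r ∧ t = l ++ w ++ r ∧
      (1 < a ∧ a ≤ 3 ∧ w = [1, a + 1] ∨ 3 < a ∧ w = [a - 2, a + 1]) := by
    rcases h with ⟨l, r, a, b, w, h, hw, hs, ht⟩ | ⟨l, r, a, b, w, h, hw, hs, ht⟩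
    · cases hw with
      | split _ ha =>
        refine ⟨l, r, a, _, h, hs, ht, ?_⟩
        rcases eq_or_lt_of_le (show 3 ≤ a from ha) with rfl | ha
        · exact Or.inl ⟨by omega, le_rfl, rfl⟩
        · exact Or.inr ⟨ha, rfl⟩
    · cases hw
      exact ⟨l, r, 2, _, h, hs, ht, Or.inl ⟨by omega, by omega, rfl⟩⟩
  rcases ha with ⟨ha, ha', rfl⟩ | ⟨ha, rfl⟩
  · have hr : r.Pairwise (· < ·) := by
      refine pairwise_lt_of_not_splitPossible (l := l ++ [a, a]) (by simpa using hpw) ?_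
      intro q hq
      simpa using h3 q (by simp at hq; omega)
    have hrA := hA r hr
      ((List.sublist_append_right (l ++ [a, a]) r).trans (by simp))
    have hl := countP_one_lt (List.pairwise_append.mp hpw).1
    have hi : l.countP (1 < ·) ≤ inversions (l ++ [1, a + 1] ++ r) := by
      simpa using countP_le_inversions_append_cons l ((a + 1) :: r) 1
    have hl' : (l.length : ℝ) ≤ inversions (l ++ [1, a + 1] ++ r) + 1 := by
      exact_mod_cast (by omega : l.length ≤ inversions (l ++ [1, a + 1] ++ r) + 1)
    have hc : (l ++ [1, a + 1] ++ r).count 1 = (l ++ a :: a :: r).count 1 + 1 := by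
      have e1 : a ≠ 1 := by omega
      have e2 : a ≠ 0 := by omega
      simp [e1, e2]
      omega
    have hlen : (l ++ [1, a + 1] ++ r).length = (l ++ a :: a :: r).length := by simp
    have hlen' : ((l ++ a :: a :: r).length : ℝ) = l.length + r.length + 2 := by
      simp; ring
    have hc0 : (0 : ℝ) ≤ (l ++ a :: a :: r).count 1 := Nat.cast_nonneg _
    simp only [potential, size, hinv, hc, hlen, hlen']
    push_cast
    nlinarith
  · have hc : (l ++ [a - 2, a + 1] ++ r).count 1 = (l ++ a :: a :: r).count 1 := by
      have e1 : a ≠ 1 := by omega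
      have e2 : a ≠ 0 := by omega
      have e3 : a - 2 ≠ 1 := by omega
      simp [e1, e2, e3]
    have hlen : (l ++ [a - 2, a + 1] ++ r).length = (l ++ a :: a :: r).length := by simp
    have hi : (0 : ℝ) ≤ inversions (l ++ [a - 2, a + 1] ++ r) := Nat.cast_nonneg _
    simp only [potential, size, hinv, hc, hlen]
    push_cast
    linarith

/-- Without a split the terms are distinct, so `size` is less than `2 * A`. There `x²/4 - A·x` is
decreasing, and a smaller `size` does no harm; the loss in `c²/4` is at most `1/4`. -/
theorem potential_merge {A : ℝ} {p : ℕ} {s t : State} (hs : ∀ i ∈ s, 1 ≤ i)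
    (hA : ∀ r : List ℕ, r.Pairwise (· < ·) → r.Sublist s → (r.length : ℝ) + 2 ≤ A)
    (h : MoveAt MoveType.merge p s t) (h1 : ∀ q, ¬ Possible MoveType.switch q s)
    (h2 : ∀ q, ¬ Possible MoveType.mergeOnes q s) (h3 : ∀ q, ¬ SplitPossible q s) :
    potential A s ≤ potential A t + 1 := by
  have hpw := pairwise_le_and_one_lt hs h1 h2
  have hinv := inversions_eq_zero (List.isChain_iff_pairwise.mp (isChain_le h1))
  have hlen := hA s (pairwise_lt_of_not_splitPossible (l := []) hpw fun q _ => h3 q)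
    (List.Sublist.refl s)
  have hc : (s.count 1 : ℝ) ≤ 1 := by exact_mod_cast count_one_le hpw
  have hsz : size t ≤ size s := by
    obtain ⟨l, r, a, b, w, rfl, hw, rfl, rfl⟩ := h
    cases hw
    have : (l ++ a :: (a + 1) :: r).count 1 ≤ (l ++ [a + 2] ++ r).count 1 + 2 := by
      simp [List.count_cons]
      split_ifs <;> omega
    have : ((l ++ a :: (a + 1) :: r).count 1 : ℝ) ≤ (l ++ [a + 2] ++ r).count 1 + 2 := by
      exact_mod_cast this
    simp only [size, List.length_append, List.length_cons, List.length_nil]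
    push_cast
    linarith
  have hi : (0 : ℝ) ≤ inversions t := Nat.cast_nonneg _
  have hc0 : (0 : ℝ) ≤ s.count 1 := Nat.cast_nonneg _
  -- This product is the change of `size ^ 2 / 4 - A * size` in factored form.
  have h4 : 0 ≤ (size s - size t) * (A - (size s + size t) / 4) := by
    refine mul_nonneg (by linarith) ?_
    have := size_le s
    linarith
  have h5 : (0 : ℝ) ≤ (t.count 1 : ℝ) ^ 2 := sq_nonneg _
  have h6 : (s.count 1 : ℝ) ^ 2 ≤ 1 := by nlinarith
  simp only [potential, hinv]
  push_cast
  linarith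

theorem potential_lgsMove {A : ℝ} {s t : State} (hs : ∀ i ∈ s, 1 ≤ i)
    (hA : ∀ r : List ℕ, r.Pairwise (· < ·) → r.Sublist s → (r.length : ℝ) + 2 ≤ A)
    (h : LGSMove s t) : potential A s ≤ potential A t + 1 := by
  cases h with
  | switch p h => exact (potential_switch A h).le
  | mergeOnes p h h1 h2 => exact potential_mergeOnes A hs h h1 h2
  | split p h h1 h2 h3 => exact potential_split hs hA h h1 h2 h3
  | merge p h h1 h2 h3 _ => exact potential_merge hs hA h h1 h2 h3

theorem potential_terminal {A : ℝ} {s : State} (hs : ∀ i ∈ s, 1 ≤ i)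
    (hA : ∀ r : List ℕ, r.Pairwise (· < ·) → r.Sublist s → (r.length : ℝ) + 2 ≤ A)
    (h : Terminal s) : potential A s ≤ 1 := by
  have h1 : ∀ k q, ¬ Possible k q s := fun k q ⟨t, ht⟩ => h t ⟨k, q, ht⟩
  have h3 : ∀ q, ¬ SplitPossible q s := by
    rintro q ⟨t, ht | ht⟩
    · exact h t ⟨_, q, ht⟩
    · exact h t ⟨_, q, ht⟩
  have hpw := pairwise_le_and_one_lt hs (h1 _) (h1 _)
  have hinv := inversions_eq_zero (List.isChain_iff_pairwise.mp (isChain_le (h1 _)))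
  have hlen := hA s (pairwise_lt_of_not_splitPossible (l := []) hpw fun q _ => h3 q)
    (List.Sublist.refl s)
  have hc : (s.count 1 : ℝ) ≤ 1 := by exact_mod_cast count_one_le hpw
  have hc0 : (0 : ℝ) ≤ s.count 1 := Nat.cast_nonneg _
  have h4 : 0 ≤ size s * (A - size s / 4) := by
    refine mul_nonneg (size_nonneg s) ?_
    have := size_le s
    have := size_nonneg s
    linarith
  have h6 : (s.count 1 : ℝ) ^ 2 ≤ 1 := by nlinarith
  simp only [potential, hinv]
  push_cast
  linarith

/-! ### The lower bound for games played by the strategy. -/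

theorem Sublist.value_le {r s : List ℕ} (h : r.Sublist s) : value r ≤ value s :=
  (h.map _).sum_le_sum (by simp)

theorem potential_start (A : ℝ) (n : ℕ) :
    (n : ℝ) ^ 2 / 2 - A * n ≤ potential A (start n) := by
  have h : (0 : ℝ) ≤ inversions (start n) := Nat.cast_nonneg _
  simp only [potential, size, start, List.length_replicate, List.count_replicate_self] at h ⊢
  linarith

theorem le_of_isLGSGameLength {n m : ℕ} (hn : 1 ≤ n) (h : IsLGSGameLength n m) :
    (n : ℝ) ^ 2 / 2 - n * Real.logb Real.goldenRatio n - (3 * n + 1) ≤ m := by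
  obtain ⟨t, ht, hT⟩ := h
  -- The 3 is the 1 of `length_le_logb` plus the 2 for the pair being split.
  set A : ℝ := Real.logb Real.goldenRatio n + 3 with hAdef
  have hA : ∀ s : State, (∀ i ∈ s, 1 ≤ i) → value s = n → ∀ r : List ℕ, r.Pairwise (· < ·) →
      r.Sublist s → (r.length : ℝ) + 2 ≤ A := by
    intro s hs hv r hr hrs
    have := length_le_logb hr (fun i hi => hs i (hrs.subset hi)) hn
      (hv ▸ Sublist.value_le hrs)
    linarith
  have key : ∀ {m s}, Steps LGSMove m (start n) s → (∀ i ∈ s, 1 ≤ i) ∧ value s = n ∧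
      potential A (start n) ≤ potential A s + m := by
    intro m s hs
    generalize hu : start n = u at hs
    induction hs with
    | refl =>
      subst hu
      refine ⟨fun i hi => (List.eq_of_mem_replicate hi).ge, by simp [value, start], by simp⟩
    | step _ h' ih =>
      obtain ⟨h1, h2, h3⟩ := ih hu
      have h4 := potential_lgsMove h1 (hA _ h1 h2) h'
      obtain ⟨k, p, h'⟩ := h'.move
      refine ⟨h'.forall_one_le h1, h'.value_eq.trans h2, ?_⟩
      push_cast
      linarith
  obtain ⟨h1, h2, h3⟩ := key ht
  have h4 := potential_terminal h1 (hA _ h1 h2) hT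
  have h5 := potential_start A n
  have h6 : A * n = n * Real.logb Real.goldenRatio n + 3 * n := by rw [hAdef]; ring
  linarith

theorem isLittleO_linear_mul_logb :
    (fun n : ℕ => -(3 * (n : ℝ) + 1)) =o[Filter.atTop]
      (fun n : ℕ => (n : ℝ) * Real.logb Real.goldenRatio (n : ℝ)) := by
  have h1 : (fun n : ℕ => -(3 * (n : ℝ) + 1)) =O[Filter.atTop] (fun n : ℕ => (n : ℝ)) := by
    refine Asymptotics.IsBigO.of_bound 4 (Filter.eventually_atTop.mpr ⟨1, fun n hn => ?_⟩)
    have hn' : (1 : ℝ) ≤ n := by exact_mod_cast hn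
    rw [norm_neg, Real.norm_of_nonneg (by linarith), Real.norm_of_nonneg (by linarith)]
    linarith
  have h2 : (fun _ : ℕ => (1 : ℝ)) =o[Filter.atTop]
      (fun n : ℕ => Real.logb Real.goldenRatio (n : ℝ)) := by
    rw [Asymptotics.isLittleO_const_left]
    right
    exact tendsto_norm_atTop_atTop.comp
      ((Real.tendsto_logb_atTop Real.one_lt_goldenRatio).comp tendsto_natCast_atTop_atTop)
  simpa using h1.mul_isLittleO h2

end OrderedZeckendorf

theorem theorem1p9 :
    ∃ e : ℕ → ℝ,
      e =o[Filter.atTop] (fun n : ℕ => (n : ℝ) * Real.logb Real.goldenRatio (n : ℝ)) ∧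
      ∀ n : ℕ, 1 ≤ n →
        -- the Long Game Strategy can be played to the end of the game
        (∃ m : ℕ, OrderedZeckendorf.IsLGSGameLength n m) ∧
        -- every game played by the Long Game Strategy is long
        (∀ m : ℕ, OrderedZeckendorf.IsLGSGameLength n m →
          (n : ℝ) ^ 2 / 2 - (n : ℝ) * Real.logb Real.goldenRatio (n : ℝ) + e n ≤ (m : ℝ)) ∧
        -- `M(n)` is a true maximum, and it satisfies the same bound
        IsGreatest {m : ℕ | OrderedZeckendorf.IsGameLength n m}
          (OrderedZeckendorf.maxGameLength n) ∧
        (n : ℝ) ^ 2 / 2 - (n : ℝ) * Real.logb Real.goldenRatio (n : ℝ) + e n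
          ≤ (OrderedZeckendorf.maxGameLength n : ℝ) := by
  -- The error term is `e n = -(3 * n + 1)`.
  refine ⟨_, OrderedZeckendorf.isLittleO_linear_mul_logb, fun n hn => ?_⟩
  have hbound : ∀ m : ℕ, OrderedZeckendorf.IsLGSGameLength n m →
      (n : ℝ) ^ 2 / 2 - (n : ℝ) * Real.logb Real.goldenRatio (n : ℝ) + -(3 * (n : ℝ) + 1) ≤ m :=
    fun m hm => by linarith [OrderedZeckendorf.le_of_isLGSGameLength hn hm]
  obtain ⟨m, hm⟩ := OrderedZeckendorf.exists_isLGSGameLength n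
  have hbdd := OrderedZeckendorf.bddAbove_isGameLength n
  have hmax : m ≤ OrderedZeckendorf.maxGameLength n := le_csSup hbdd hm.isGameLength
  exact ⟨⟨m, hm⟩, hbound,
    -- Nonemptiness and boundedness rule out the default value 0 of `sSup` on `ℕ`.
    ⟨Nat.sSup_mem ⟨m, hm.isGameLength⟩ hbdd, fun k hk => le_csSup hbdd hk⟩,
    (hbound m hm).trans (by exact_mod_cast hmax)⟩
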